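/- Let $\mathbb{T}^2=(\mathbb{R}/2\pi\mathbb{Z})^2$ with coordinates $(x,y)$ and flat metric $g_0=dx^2+dy^2$. A Liouville metric on $\mathbb{T}^2$ is a Riemannian metric of the form $g=Q(x)\,(dx^2+dy^2)$ with $Q>0$ a function on $\mathbb{R}/2\pi\mathbb{Z}$; $\Delta_g$ denotes its Laplace--Beltrami operator, and the eigenvalues $\lambda_1(g)\le\lambda_2(g)\le\cdots$ of $-\Delta_g$ are listed in non-decreasing order, with multiplicities, starting from the label $1$ (so $\lambda_1(g)=0$). Let $n\ge 0$ be an integer and, for $a\in\mathbb{R}$, put $\Phi_a(x,y)=(1+a\cos(nx))\cos y$. (1) For every $k\in\mathbb{N}$ and $\varepsilon>0$ there is $a_0>0$ such that for every $a\in(0,a_0)$ there is a real-analytic Liouville metric $g$ on $\mathbb{T}^2$ which is $\varepsilon$-close to $g_0$ in $C^k$ (all derivatives of order at most $k$ of the coefficients of $g-g_0$ are less than $\varepsilon$ in norm everywhere), for which $\Phi_a$ is an eigenfunction with eigenvalue $1$, $-\Delta_g\Phi_a=\Phi_a$, and such that the super-level set $\{\Phi_a>1\}\subset\mathbb{T}^2$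 has at least $n$ connected components. (2) If $n\ge 4$, there is $\delta>0$ such that for every $a\in\mathbb{R}$ and every real-analytic Liouville metric $g$ on $\mathbb{T}^2$ that is $\delta$-close to $g_0$ in $C^0$ and for which $\Phi_a$ is an eigenfunction of $-\Delta_g$ with eigenvalue $1$, the eigenvalue $1$ is the second, third or fourth eigenvalue of $-\Delta_g$, that is, $1\in\{\lambda_2(g),\lambda_3(g),\lambda_4(g)\}$. -/

import Mathlib

open scoped ContDiff

noncomputable section

/-- The torus `(ℝ / 2πℤ)²`; `Real.Angle` is `ℝ / 2πℤ` with its quotient topology. -/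
abbrev Torus : Type := Real.Angle × Real.Angle

namespace Torus

/-- The doubly `2π`-periodic function on `ℝ²` that corresponds to a function on the torus. -/
def lift (u : Torus → ℝ) : ℝ × ℝ → ℝ :=
  fun p => u ((p.1 : Real.Angle), (p.2 : Real.Angle))

/-- `C^∞` functions on the torus. -/
def IsSmooth (u : Torus → ℝ) : Prop := ContDiff ℝ ∞ (lift u)

/-- Real analytic functions on the torus. -/
def IsRealAnalytic (u : Torus → ℝ) : Prop := AnalyticOnNhd ℝ (lift u) Set.univ

/-- The coordinate direction `x` (index `0`) or `y` (index `1`), scaled by `t`. -/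
def dir (i : Fin 2) (t : ℝ) : Torus :=
  if i = 0 then ((t : Real.Angle), 0) else (0, (t : Real.Angle))

/-- The partial derivative `∂u/∂x` (index `0`) or `∂u/∂y` (index `1`). -/
def partialDeriv (i : Fin 2) (u : Torus → ℝ) : Torus → ℝ :=
  fun p => deriv (fun t : ℝ => u (p + dir i t)) 0

/-- A smooth Riemannian metric `∑ gᵢⱼ dxᵢ dxⱼ` on the torus, in the global coordinates
`(x, y)`. -/
structure Metric where
  coeff : Torus → Matrix (Fin 2) (Fin 2) ℝ
  smooth : ∀ i j, IsSmooth (fun p => coeff p i j)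
  posDef : ∀ p, (coeff p).PosDef

namespace Metric

/-- The flat metric `dx² + dy²`. -/
def flat : Metric where
  coeff := fun _ => 1
  smooth := fun i j => contDiff_const (c := (1 : Matrix (Fin 2) (Fin 2) ℝ) i j)
  posDef := fun _ => Matrix.PosDef.one

/-- All coefficients of the metric are real analytic. -/
def IsRealAnalytic (g : Metric) : Prop :=
  ∀ i j, Torus.IsRealAnalytic (fun p => g.coeff p i j)

/-- The metric is of the form `Q(x) (dx² + dy²)`. -/
def IsLiouville (g : Metric) : Prop :=
  ∃ Q : Real.Angle → ℝ, ∀ p, g.coeff p = Q p.1 • (1 : Matrix (Fin 2) (Fin 2) ℝ)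

/-- The derivatives of order at most `k` of the coefficients of `g` and `h` differ
by less than `ε` everywhere. -/
def IsCkClose (k : ℕ) (ε : ℝ) (g h : Metric) : Prop :=
  ∀ m ≤ k, ∀ i j, ∀ p : ℝ × ℝ,
    ‖iteratedFDeriv ℝ m (lift (fun q => g.coeff q i j - h.coeff q i j)) p‖ < ε

/-- The Laplace-Beltrami operator
`Δ_g u = (det g)^(-1/2) ∑ᵢⱼ ∂ᵢ ((det g)^(1/2) gⁱʲ ∂ⱼ u)`. -/
def laplaceBeltrami (g : Metric) (u : Torus → ℝ) : Torus → ℝ :=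
  fun p => (Real.sqrt (g.coeff p).det)⁻¹ *
    ∑ i, partialDeriv i
      (fun q => ∑ j, Real.sqrt (g.coeff q).det * (g.coeff q)⁻¹ i j * partialDeriv j u q) p

/-- `u` is an eigenfunction of `-Δ_g` with eigenvalue `μ`. -/
def IsEigenfunction (g : Metric) (μ : ℝ) (u : Torus → ℝ) : Prop :=
  u ≠ 0 ∧ IsSmooth u ∧ ∀ p, -(laplaceBeltrami g u p) = μ * u p

/-- The span of all eigenfunctions of `-Δ_g` whose eigenvalue lies in `s`. -/
def eigenSpan (g : Metric) (s : Set ℝ) : Submodule ℝ (Torus → ℝ) :=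
  Submodule.span ℝ {u | ∃ μ ∈ s, g.IsEigenfunction μ u}

/-- `μ` is the `k`-th eigenvalue `μ_k` of `-Δ_g`, where the eigenvalues `μ₁ ≤ μ₂ ≤ …` are listed in
non-decreasing order, with multiplicities, starting from the label `1`: fewer than `k` eigenvalues
are smaller than `μ`, and at least `k` of them are at most `μ`. -/
def IsKthEigenvalue (g : Metric) (k : ℕ) (μ : ℝ) : Prop :=
  Module.rank ℝ (g.eigenSpan (Set.Iio μ)) < (k : Cardinal) ∧
    (k : Cardinal) ≤ Module.rank ℝ (g.eigenSpan (Set.Iic μ))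

end Metric

/-- The function `(1 + a cos(nx)) cos y`. -/
def trigProduct (n : ℕ) (a : ℝ) : Torus → ℝ :=
  fun p => (1 + a * Real.Angle.cos (n • p.1)) * Real.Angle.cos p.2

/-- The number of connected components of a subset of the torus. -/
def numComponents (S : Set Torus) : ℕ∞ := ENat.card (ConnectedComponents S)

end Torus

end

/-!
For a metric `q (dx² + dy²)` the equation `-Δ_g u = μ u` reads `-Δ₀ u = μ q u`, where `Δ₀` is the
flat Laplacian.

`Φ_a` solves it with `μ = 1` and `q = 1 + n² a cos (n x) / (1 + a cos (n x))`, which tends to `1`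
in every `C^k` as `a → 0`. Where `Φ_a > 1` one has `cos (n x) > 0`, so that `n x` has a
representative `r` in `(-π, π)`, and `x - r / n` is a locally constant function that attains all `n`
of the `n`-torsion points.

If `q` depends on `x` only, then `∂_y` preserves the eigenspaces, so `Φ_a` and `∂_y Φ_a` make the
eigenvalue `1` at least double, and the eigenvalue `0` lies below it. If moreover `q < 2`, then an
eigenfunction sum `u` with eigenvalues at most `1` satisfies `∫ |∇u|² ≤ ∫ q u² < 2 ∫ u²`, hence is
not orthogonal to all five Fourier modes of frequency `|m|² < 2`; so there are at most five
eigenvalues up to `1`, and at most three below `1`.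
-/

noncomputable section

namespace Torus

open MeasureTheory

/-- The covering map `ℝ² → (ℝ / 2πℤ)²`. -/
def proj (q : ℝ × ℝ) : Torus := (q.1, q.2)

/-- The coordinate vectors of `ℝ²`, the velocities of the curves `dir i`. -/
def basisVec (i : Fin 2) : ℝ × ℝ := if i = 0 then (1, 0) else (0, 1)

lemma proj_surjective : Function.Surjective proj :=
  QuotientAddGroup.mk_surjective.prodMap QuotientAddGroup.mk_surjective

lemma proj_add_dir (q : ℝ × ℝ) (i : Fin 2) (t : ℝ) :
    proj q + dir i t = proj (q + t • basisVec i) := by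
  fin_cases i <;> simp [proj, dir, basisVec]

lemma dir_add (i : Fin 2) (s t : ℝ) : dir i (s + t) = dir i s + dir i t := by
  fin_cases i <;> simp [dir]

lemma dir_zero (i : Fin 2) : dir i 0 = 0 := by
  fin_cases i <;> simp [dir]

lemma continuous_of_continuous_lift {u : Torus → ℝ} (hu : Continuous (lift u)) :
    Continuous u := by
  have h : IsOpenQuotientMap ((↑) : ℝ → Real.Angle) := QuotientAddGroup.isOpenQuotientMap_mk
  exact (h.prodMap h).isQuotientMap.continuous_iff.mpr hu

/-! ### Derivatives of smooth functions on the torus -/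

/-- The algebra `C^∞(𝕋²)`. -/
def smoothFunctions : Subalgebra ℝ (Torus → ℝ) where
  carrier := {u | IsSmooth u}
  mul_mem' (hu : IsSmooth _) (hv : IsSmooth _) := ContDiff.mul hu hv
  add_mem' (hu : IsSmooth _) (hv : IsSmooth _) := ContDiff.add hu hv
  algebraMap_mem' c := show IsSmooth _ from contDiff_const (c := c)

/-- A `C^∞` function on the torus. -/
abbrev SmoothFunction : Type := smoothFunctions

namespace SmoothFunction

lemma contDiff (u : SmoothFunction) : ContDiff ℝ ∞ (lift u.1) := u.2

lemma continuous (u : SmoothFunction) : Continuous u.1 :=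
  continuous_of_continuous_lift (u.contDiff.continuous)

lemma hasDerivAt_dir_zero (u : SmoothFunction) (q : ℝ × ℝ) (i : Fin 2) :
    HasDerivAt (fun t ↦ u.1 (proj q + dir i t)) (fderiv ℝ (lift u.1) q (basisVec i)) 0 := by
  simp only [proj_add_dir]
  exact (u.contDiff.differentiable (by simp) q).hasFDerivAt.hasLineDerivAt (basisVec i)

lemma lift_partialDeriv (u : SmoothFunction) (i : Fin 2) :
    lift (partialDeriv i u.1) = fun q ↦ fderiv ℝ (lift u.1) q (basisVec i) :=
  funext fun q ↦ (u.hasDerivAt_dir_zero q i).deriv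

lemma isSmooth_partialDeriv (u : SmoothFunction) (i : Fin 2) :
    IsSmooth (partialDeriv i u.1) := by
  rw [IsSmooth, lift_partialDeriv]
  exact (u.contDiff.fderiv_right (by simp)).clm_apply contDiff_const

lemma hasDerivAt_dir (u : SmoothFunction) (p : Torus) (i : Fin 2) (t : ℝ) :
    HasDerivAt (fun t ↦ u.1 (p + dir i t)) (partialDeriv i u.1 (p + dir i t)) t := by
  have h : HasDerivAt (fun s ↦ u.1 (p + dir i t + dir i s))
      (partialDeriv i u.1 (p + dir i t)) (t - t) := by
    obtain ⟨q, hq⟩ := proj_surjective (p + dir i t)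
    rw [← hq, sub_self]
    exact (u.hasDerivAt_dir_zero q i).differentiableAt.hasDerivAt
  simpa only [add_assoc, ← dir_add, add_sub_cancel] using h.comp_sub_const t t

lemma hasDerivAt (u : SmoothFunction) (p : Torus) (i : Fin 2) :
    HasDerivAt (fun t ↦ u.1 (p + dir i t)) (partialDeriv i u.1 p) 0 := by
  simpa only [dir_zero, add_zero] using u.hasDerivAt_dir p i 0

/-- The partial derivatives as derivations of `C^∞(𝕋²)`. -/
def pderiv (i : Fin 2) : Derivation ℝ SmoothFunction SmoothFunction :=
  Derivation.mk'
    { toFun u := ⟨partialDeriv i u.1, u.isSmooth_partialDeriv i⟩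
      map_add' u v := Subtype.ext <| funext fun p ↦
        ((u.hasDerivAt p i).add (v.hasDerivAt p i)).deriv
      map_smul' c u := Subtype.ext <| funext fun p ↦ ((u.hasDerivAt p i).const_smul c).deriv }
    fun u v ↦ Subtype.ext <| funext fun p ↦ by
      have h := ((u.hasDerivAt p i).mul (v.hasDerivAt p i)).deriv
      simp only [dir_zero, add_zero] at h
      exact h.trans (by simp [smul_eq_mul, mul_comm, add_comm])

lemma coe_pderiv (i : Fin 2) (u : SmoothFunction) : (pderiv i u).1 = partialDeriv i u.1 := rfl

lemma pderiv_comm (i j : Fin 2) (u : SmoothFunction) :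
    pderiv i (pderiv j u) = pderiv j (pderiv i u) := by
  have h (i j : Fin 2) (q : ℝ × ℝ) : (pderiv i (pderiv j u)).1 (proj q) =
      fderiv ℝ (fderiv ℝ (lift u.1)) q (basisVec i) (basisVec j) := by
    have hd : DifferentiableAt ℝ (fderiv ℝ (lift u.1)) q :=
      (u.contDiff.fderiv_right (m := ∞) (by simp)).differentiable (by simp) q
    refine (congrFun (lift_partialDeriv (pderiv j u) i) q).trans ?_
    rw [coe_pderiv, lift_partialDeriv, fderiv_clm_apply hd (differentiableAt_const _)]
    simp
  refine Subtype.ext (funext fun p ↦ ?_)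
  obtain ⟨q, rfl⟩ := proj_surjective p
  rw [h, h]
  exact (u.contDiff.contDiffAt).isSymmSndFDerivAt (by simp [ENat.LEInfty.out]) _ _

/-- The Laplacian of the flat metric. -/
def laplacian : SmoothFunction →ₗ[ℝ] SmoothFunction :=
  ∑ i, (pderiv i : SmoothFunction →ₗ[ℝ] SmoothFunction) ∘ₗ pderiv i

lemma laplacian_apply (u : SmoothFunction) : laplacian u = ∑ i, pderiv i (pderiv i u) := by
  simp [laplacian]

lemma laplacian_pderiv (i : Fin 2) (u : SmoothFunction) :
    laplacian (pderiv i u) = pderiv i (laplacian u) := by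
  simp only [laplacian_apply, map_sum, pderiv_comm _ i]

/-! ### Means and Fourier coefficients -/

section Fourier

/-- The circle `ℝ / ℤ` with its Haar probability measure. -/
local instance : MeasureSpace UnitAddCircle := ⟨AddCircle.haarAddCircle⟩

local instance : Measure.IsAddHaarMeasure (volume : Measure UnitAddCircle) :=
  inferInstanceAs (Measure.IsAddHaarMeasure AddCircle.haarAddCircle)

local instance : IsProbabilityMeasure (volume : Measure UnitAddCircle) :=
  inferInstanceAs (IsProbabilityMeasure AddCircle.haarAddCircle)

/-- The rescaling of `(ℝ / ℤ)²`, where Mathlib develops Fourier series, to `(ℝ / 2πℤ)²`. -/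
def ofUnitTorus : UnitAddTorus (Fin 2) →+ Torus :=
  let e : UnitAddCircle →+ Real.Angle :=
    (AddCircle.equivAddCircle 1 (2 * Real.pi) one_ne_zero Real.two_pi_pos.ne').toAddMonoidHom
  (e.comp (Pi.evalAddMonoidHom _ 0)).prod (e.comp (Pi.evalAddMonoidHom _ 1))

lemma ofUnitTorus_coe (x : Fin 2 → ℝ) :
    ofUnitTorus (fun i ↦ (x i : UnitAddCircle)) = proj (2 * Real.pi * x 0, 2 * Real.pi * x 1) := by
  have h (t : ℝ) : AddCircle.equivAddCircle 1 (2 * Real.pi) one_ne_zero Real.two_pi_pos.ne' t =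
      ((2 * Real.pi * t : ℝ) : Real.Angle) := by
    exact (AddCircle.equivAddCircle_apply_mk ..).trans
      (congrArg ((↑) : ℝ → Real.Angle) (by ring))
  exact Prod.ext (h _) (h _)

lemma continuous_ofUnitTorus : Continuous ofUnitTorus :=
  have h := (AddCircle.homeomorphAddCircle 1 (2 * Real.pi) one_ne_zero
    Real.two_pi_pos.ne').continuous
  (h.comp (continuous_apply 0)).prodMk (h.comp (continuous_apply 1))

lemma ofUnitTorus_surjective : Function.Surjective ofUnitTorus := by
  intro p
  obtain ⟨q, rfl⟩ := proj_surjective p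
  refine ⟨fun i ↦ ((![q.1, q.2] i / (2 * Real.pi) : ℝ) : UnitAddCircle), ?_⟩
  rw [ofUnitTorus_coe, mul_div_cancel₀ _ Real.two_pi_pos.ne',
    mul_div_cancel₀ _ Real.two_pi_pos.ne']
  rfl

lemma compactSpace_torus : CompactSpace Torus :=
  ofUnitTorus_surjective.compactSpace continuous_ofUnitTorus

lemma continuous_comp_ofUnitTorus (u : SmoothFunction) :
    Continuous fun x ↦ u.1 (ofUnitTorus x) :=
  u.continuous.comp continuous_ofUnitTorus

lemma integrable_comp_ofUnitTorus (u : SmoothFunction) :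
    Integrable fun x ↦ u.1 (ofUnitTorus x) :=
  u.continuous_comp_ofUnitTorus.integrable_of_hasCompactSupport (.of_compactSpace _)

/-- The average of a function over the torus. -/
def mean : SmoothFunction →ₗ[ℝ] ℝ where
  toFun u := ∫ x, u.1 (ofUnitTorus x)
  map_add' u v := integral_add u.integrable_comp_ofUnitTorus v.integrable_comp_ofUnitTorus
  map_smul' c _ := integral_const_mul c _

lemma mean_apply (u : SmoothFunction) : mean u = ∫ x, u.1 (ofUnitTorus x) := rfl

lemma mean_nonneg {u : SmoothFunction} (h : 0 ≤ u.1) : 0 ≤ mean u :=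
  integral_nonneg fun _ ↦ h _

lemma eq_zero_of_mean_nonpos {u : SmoothFunction} (hu : 0 ≤ u.1) (h : mean u ≤ 0) : u = 0 := by
  by_contra hne
  obtain ⟨p, hp⟩ := Function.ne_iff.mp (Subtype.coe_ne_coe.mpr hne)
  obtain ⟨x, rfl⟩ := ofUnitTorus_surjective p
  exact h.not_gt <| u.continuous_comp_ofUnitTorus.integral_pos_of_hasCompactSupport_nonneg_nonzero
    (.of_compactSpace _) (fun _ ↦ hu _) hp

lemma mean_translate (u : SmoothFunction) (p : Torus) :
    ∫ x, u.1 (ofUnitTorus x + p) = mean u := by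
  obtain ⟨y, rfl⟩ := ofUnitTorus_surjective p
  simp only [← map_add]
  exact integral_add_right_eq_self (fun x ↦ u.1 (ofUnitTorus x)) y

/- The mean of `u` translated by `dir i t` does not depend on `t`; differentiate at `t = 0`. -/
lemma mean_pderiv (i : Fin 2) (u : SmoothFunction) : mean (pderiv i u) = 0 := by
  have hcont (v : SmoothFunction) (t : ℝ) : Continuous fun x ↦ v.1 (ofUnitTorus x + dir i t) :=
    v.continuous.comp (continuous_ofUnitTorus.add continuous_const)
  have := compactSpace_torus
  obtain ⟨C, hC⟩ := (isCompact_range (pderiv i u).continuous).isBounded.exists_norm_le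
  have hderiv := (hasDerivAt_integral_of_dominated_loc_of_deriv_le (μ := volume)
    (F' := fun t x ↦ (pderiv i u).1 (ofUnitTorus x + dir i t))
    (x₀ := (0 : ℝ)) (bound := fun _ ↦ C) Filter.univ_mem
    (.of_forall fun t ↦ (hcont u t).aestronglyMeasurable)
    ((hcont u 0).integrable_of_hasCompactSupport (.of_compactSpace _))
    (hcont (pderiv i u) 0).aestronglyMeasurable
    (.of_forall fun _ _ _ ↦ hC _ (Set.mem_range_self _)) (integrable_const C)
    (.of_forall fun x t _ ↦ u.hasDerivAt_dir (ofUnitTorus x) i t)).2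
  simp only [mean_translate] at hderiv
  have h0 := hderiv.unique (hasDerivAt_const 0 _)
  simpa only [dir_zero, add_zero] using h0

lemma mean_mul_pderiv (i : Fin 2) (u v : SmoothFunction) :
    mean (u * pderiv i v) = -mean (pderiv i u * v) := by
  have h := mean_pderiv i (u * v)
  rw [Derivation.leibniz, map_add, smul_eq_mul, smul_eq_mul, mul_comm v] at h
  exact eq_neg_of_add_eq_zero_left h

lemma mean_mul_laplacian (u v : SmoothFunction) :
    mean (u * laplacian v) = -∑ i, mean (pderiv i u * pderiv i v) := by
  simp only [laplacian_apply, Finset.mul_sum, map_sum, mean_mul_pderiv, Finset.sum_neg_distrib]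

lemma mean_mul_laplacian_comm (u v : SmoothFunction) :
    mean (u * laplacian v) = mean (v * laplacian u) := by
  simp only [mean_mul_laplacian, mul_comm]

/-- The phase `m₀ x + m₁ y` of the Fourier modes of frequency `m`. -/
def phase (m : Fin 2 → ℤ) : Torus →+ Real.Angle :=
  m 0 • AddMonoidHom.fst _ _ + m 1 • AddMonoidHom.snd _ _

lemma phase_apply (m : Fin 2 → ℤ) (p : Torus) : phase m p = m 0 • p.1 + m 1 • p.2 := rfl

lemma phase_neg (m : Fin 2 → ℤ) (p : Torus) : phase (-m) p = -phase m p := by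
  simp only [phase_apply, Pi.neg_apply, neg_smul, neg_add]

lemma phase_proj (m : Fin 2 → ℤ) (q : ℝ × ℝ) :
    phase m (proj q) = ((m 0 * q.1 + m 1 * q.2 : ℝ) : Real.Angle) := by
  simp [phase_apply, proj]

lemma phase_dir (m : Fin 2 → ℤ) (i : Fin 2) (t : ℝ) :
    phase m (dir i t) = ((m i * t : ℝ) : Real.Angle) := by
  fin_cases i <;> simp [phase_apply, dir]

/-- The real Fourier mode `cos (m₀ x + m₁ y)`. -/
def cosMode (m : Fin 2 → ℤ) : SmoothFunction :=
  ⟨fun p ↦ (phase m p).cos, by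
    have h : lift (fun p ↦ (phase m p).cos) = fun q ↦ Real.cos (m 0 * q.1 + m 1 * q.2) :=
      funext fun q ↦ congrArg Real.Angle.cos (phase_proj m q)
    change ContDiff ℝ ∞ _
    rw [h]
    fun_prop⟩

/-- The real Fourier mode `sin (m₀ x + m₁ y)`. -/
def sinMode (m : Fin 2 → ℤ) : SmoothFunction :=
  ⟨fun p ↦ (phase m p).sin, by
    have h : lift (fun p ↦ (phase m p).sin) = fun q ↦ Real.sin (m 0 * q.1 + m 1 * q.2) :=
      funext fun q ↦ congrArg Real.Angle.sin (phase_proj m q)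
    change ContDiff ℝ ∞ _
    rw [h]
    fun_prop⟩

lemma cosMode_apply (m : Fin 2 → ℤ) (p : Torus) : (cosMode m).1 p = (phase m p).cos := rfl

lemma sinMode_apply (m : Fin 2 → ℤ) (p : Torus) : (sinMode m).1 p = (phase m p).sin := rfl

lemma cosMode_neg (m : Fin 2 → ℤ) : cosMode (-m) = cosMode m :=
  Subtype.ext <| funext fun p ↦ by simp only [cosMode_apply, phase_neg, Real.Angle.cos_neg]

lemma sinMode_neg (m : Fin 2 → ℤ) : sinMode (-m) = (-1 : ℝ) • sinMode m :=
  Subtype.ext <| funext fun p ↦ by simp [sinMode_apply, phase_neg]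

lemma hasDerivAt_phase_cos (m : Fin 2 → ℤ) (i : Fin 2) (p : Torus) :
    HasDerivAt (fun t ↦ (phase m (p + dir i t)).cos) (-(m i * (phase m p).sin)) 0 := by
  obtain ⟨q, rfl⟩ := proj_surjective p
  simp only [map_add, phase_proj, phase_dir, ← Real.Angle.coe_add, Real.Angle.cos_coe,
    Real.Angle.sin_coe]
  simpa [mul_comm] using
    (((hasDerivAt_id (0 : ℝ)).const_mul (m i : ℝ)).const_add (m 0 * q.1 + m 1 * q.2)).cos

lemma hasDerivAt_phase_sin (m : Fin 2 → ℤ) (i : Fin 2) (p : Torus) :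
    HasDerivAt (fun t ↦ (phase m (p + dir i t)).sin) (m i * (phase m p).cos) 0 := by
  obtain ⟨q, rfl⟩ := proj_surjective p
  simp only [map_add, phase_proj, phase_dir, ← Real.Angle.coe_add, Real.Angle.cos_coe,
    Real.Angle.sin_coe]
  simpa [mul_comm] using
    (((hasDerivAt_id (0 : ℝ)).const_mul (m i : ℝ)).const_add (m 0 * q.1 + m 1 * q.2)).sin

lemma pderiv_cosMode (i : Fin 2) (m : Fin 2 → ℤ) :
    pderiv i (cosMode m) = -(m i : ℝ) • sinMode m :=
  Subtype.ext <| funext fun p ↦ (hasDerivAt_phase_cos m i p).deriv.trans (neg_mul ..).symm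

lemma pderiv_sinMode (i : Fin 2) (m : Fin 2 → ℤ) :
    pderiv i (sinMode m) = (m i : ℝ) • cosMode m :=
  Subtype.ext <| funext fun p ↦ (hasDerivAt_phase_sin m i p).deriv

lemma pderiv_pderiv_cosMode (i : Fin 2) (m : Fin 2 → ℤ) :
    pderiv i (pderiv i (cosMode m)) = -(m i : ℝ) ^ 2 • cosMode m := by
  rw [pderiv_cosMode, Derivation.map_smul, pderiv_sinMode, smul_smul]
  ring_nf

/-- The squared modulus of the Fourier coefficient of `u` at the frequency `m`. -/
def sqFourierCoeff (m : Fin 2 → ℤ) (u : SmoothFunction) : ℝ :=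
  mean (cosMode m * u) ^ 2 + mean (sinMode m * u) ^ 2

lemma sqFourierCoeff_pderiv (m : Fin 2 → ℤ) (i : Fin 2) (u : SmoothFunction) :
    sqFourierCoeff m (pderiv i u) = (m i : ℝ) ^ 2 * sqFourierCoeff m u := by
  simp only [sqFourierCoeff, mean_mul_pderiv, pderiv_cosMode, pderiv_sinMode, smul_mul_assoc,
    map_smul, smul_eq_mul]
  ring

lemma mFourier_neg_apply (m : Fin 2 → ℤ) (x : UnitAddTorus (Fin 2)) :
    UnitAddTorus.mFourier (-m) x =
      (cosMode m).1 (ofUnitTorus x) - (sinMode m).1 (ofUnitTorus x) * Complex.I := by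
  obtain ⟨y, rfl⟩ : ∃ y : Fin 2 → ℝ, (fun i ↦ (y i : UnitAddCircle)) = x :=
    Function.Surjective.piMap (fun _ ↦ QuotientAddGroup.mk_surjective) x
  rw [ofUnitTorus_coe, cosMode_apply, sinMode_apply, phase_proj, Real.Angle.cos_coe,
    Real.Angle.sin_coe, Complex.ofReal_cos, Complex.ofReal_sin, Complex.cos_sub_sin_I]
  simp only [UnitAddTorus.mFourier, ContinuousMap.coe_mk, Fin.prod_univ_two, fourier_coe_apply,
    ← Complex.exp_add]
  congr 1
  push_cast [Pi.neg_apply]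
  ring

lemma normSq_mFourierCoeff (m : Fin 2 → ℤ) (u : SmoothFunction) :
    ‖UnitAddTorus.mFourierCoeff (fun x ↦ (u.1 (ofUnitTorus x) : ℂ)) m‖ ^ 2 =
      sqFourierCoeff m u := by
  have hsplit : UnitAddTorus.mFourierCoeff (fun x ↦ (u.1 (ofUnitTorus x) : ℂ)) m =
      ∫ x, (((cosMode m * u).1 (ofUnitTorus x) : ℂ) -
        (sinMode m * u).1 (ofUnitTorus x) * Complex.I) := by
    refine integral_congr_ae (.of_forall fun x ↦ ?_)
    simp only [mFourier_neg_apply, smul_eq_mul, MulMemClass.coe_mul, Pi.mul_apply,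
      Complex.ofReal_mul]
    ring
  have hcos : Integrable fun x ↦ ((cosMode m * u).1 (ofUnitTorus x) : ℂ) :=
    (integrable_comp_ofUnitTorus (cosMode m * u)).ofReal
  have hsin : Integrable fun x ↦ ((sinMode m * u).1 (ofUnitTorus x) : ℂ) * Complex.I :=
    (integrable_comp_ofUnitTorus (sinMode m * u)).ofReal.mul_const _
  rw [hsplit, integral_sub hcos hsin, integral_mul_const, integral_complex_ofReal,
    integral_complex_ofReal, ← mean_apply, ← mean_apply, ← Complex.normSq_eq_norm_sq,
    Complex.normSq_apply, sqFourierCoeff]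
  simp [pow_two]

lemma hasSum_sqFourierCoeff (u : SmoothFunction) :
    HasSum (fun m ↦ sqFourierCoeff m u) (mean (u * u)) := by
  let w : C(UnitAddTorus (Fin 2), ℂ) :=
    ⟨fun x ↦ (u.1 (ofUnitTorus x) : ℂ), Complex.continuous_ofReal.comp
      u.continuous_comp_ofUnitTorus⟩
  have hnorm : ∫ x, ‖ContinuousMap.toLp 2 volume ℂ w x‖ ^ 2 = mean (u * u) := by
    refine integral_congr_ae ?_
    filter_upwards [ContinuousMap.coeFn_toLp (p := 2) (𝕜 := ℂ) volume w] with x hx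
    rw [hx]
    simp [w, pow_two]
  have h := UnitAddTorus.hasSum_sq_mFourierCoeff (ContinuousMap.toLp 2 volume ℂ w)
  rw [hnorm] at h
  refine h.congr_fun fun m ↦ ?_
  rw [UnitAddTorus.mFourierCoeff_toLp, ← normSq_mFourierCoeff]
  rfl

lemma hasSum_mul_sqFourierCoeff (u : SmoothFunction) :
    HasSum (fun m ↦ (∑ i, (m i : ℝ) ^ 2) * sqFourierCoeff m u) (-mean (u * laplacian u)) := by
  simp only [mean_mul_laplacian, neg_neg, Finset.sum_mul, ← sqFourierCoeff_pderiv]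
  exact hasSum_sum fun i _ ↦ hasSum_sqFourierCoeff (pderiv i u)

lemma mul_mean_sq_le_of_sqFourierCoeff_eq_zero {S : Set (Fin 2 → ℤ)} {r : ℝ}
    (hS : ∀ m ∉ S, r ≤ ∑ i, (m i : ℝ) ^ 2) {u : SmoothFunction}
    (hu : ∀ m ∈ S, sqFourierCoeff m u = 0) :
    r * mean (u * u) ≤ -mean (u * laplacian u) := by
  refine hasSum_le (fun m ↦ ?_) ((hasSum_sqFourierCoeff u).mul_left r)
    (hasSum_mul_sqFourierCoeff u)
  by_cases hm : m ∈ S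
  · simp only [hu m hm, mul_zero, le_refl]
  · exact mul_le_mul_of_nonneg_right (hS m hm) (by rw [sqFourierCoeff]; positivity)

end Fourier

/-! ### The weighted eigenvalue problem -/

/-- The smooth solutions of `-Δu = μ q u`. -/
def weightedEigenspace (q : SmoothFunction) (μ : ℝ) : Submodule ℝ SmoothFunction :=
  LinearMap.eqLocus laplacian (-μ • LinearMap.mulLeft ℝ q)

/-- The span of the smooth solutions of `-Δu = μ q u` for all `μ ∈ s`. -/
def weightedEigenspan (q : SmoothFunction) (s : Set ℝ) : Submodule ℝ SmoothFunction :=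
  ⨆ μ ∈ s, weightedEigenspace q μ

section Weighted

variable {q u v : SmoothFunction} {μ ν : ℝ} {s : Set ℝ}

lemma mem_weightedEigenspace : u ∈ weightedEigenspace q μ ↔ laplacian u = -μ • (q * u) :=
  LinearMap.mem_eqLocus

lemma one_mem_weightedEigenspace_zero (q : SmoothFunction) : 1 ∈ weightedEigenspace q 0 := by
  simp [mem_weightedEigenspace, laplacian_apply]

lemma pderiv_mem_weightedEigenspace {i : Fin 2} (hq : pderiv i q = 0)
    (hu : u ∈ weightedEigenspace q μ) : pderiv i u ∈ weightedEigenspace q μ := by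
  rw [mem_weightedEigenspace] at hu ⊢
  simp [laplacian_pderiv, hu, hq]

lemma weightedEigenspace_le_weightedEigenspan (hμ : μ ∈ s) :
    weightedEigenspace q μ ≤ weightedEigenspan q s :=
  le_iSup₂_of_le μ hμ le_rfl

lemma mean_mul_laplacian_of_mem_weightedEigenspace (u : SmoothFunction)
    (hv : v ∈ weightedEigenspace q ν) :
    mean (u * laplacian v) = -ν * mean (q * (u * v)) := by
  rw [mem_weightedEigenspace.mp hv, mul_smul_comm, map_smul, smul_eq_mul, mul_left_comm]

lemma mean_mul_eq_zero_of_mem_weightedEigenspace (hμν : μ ≠ ν)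
    (hu : u ∈ weightedEigenspace q μ) (hv : v ∈ weightedEigenspace q ν) :
    mean (q * (u * v)) = 0 := by
  have h := mean_mul_laplacian_comm u v
  rw [mean_mul_laplacian_of_mem_weightedEigenspace u hv,
    mean_mul_laplacian_of_mem_weightedEigenspace v hu, mul_comm v u] at h
  exact (mul_eq_mul_right_iff.mp h).resolve_left (neg_injective.ne hμν.symm)

lemma eq_zero_of_mean_mul_sq_nonpos (hq : ∀ p, 0 < q.1 p) (hu : mean (q * (u * u)) ≤ 0) :
    u = 0 := by
  have h := eq_zero_of_mean_nonpos (fun p ↦ mul_nonneg (hq p).le (mul_self_nonneg _)) hu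
  refine Subtype.ext (funext fun p ↦ ?_)
  exact mul_self_eq_zero.mp
    ((mul_eq_zero.mp (congrFun (congrArg Subtype.val h) p)).resolve_left (hq p).ne')

lemma disjoint_weightedEigenspan (hq : ∀ p, 0 < q.1 p) (hμ : μ ∉ s) :
    Disjoint (weightedEigenspace q μ) (weightedEigenspan q s) := by
  refine Submodule.disjoint_def.mpr fun u hu hus ↦ eq_zero_of_mean_mul_sq_nonpos hq ?_
  have hle : weightedEigenspan q s ≤
      LinearMap.ker (mean ∘ₗ LinearMap.mulLeft ℝ q ∘ₗ LinearMap.mulLeft ℝ u) :=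
    iSup₂_le fun ν hν v hv ↦ mean_mul_eq_zero_of_mem_weightedEigenspace
      (ne_of_mem_of_not_mem hν hμ).symm hu hv
  exact (hle hus).le

lemma rank_weightedEigenspan_insert (hq : ∀ p, 0 < q.1 p) (hμ : μ ∉ s) :
    Module.rank ℝ (weightedEigenspan q (insert μ s)) =
      Module.rank ℝ (weightedEigenspace q μ) + Module.rank ℝ (weightedEigenspan q s) := by
  have h := Submodule.rank_sup_add_rank_inf_eq (weightedEigenspace q μ) (weightedEigenspan q s)
  rwa [(disjoint_weightedEigenspan hq hμ).eq_bot, rank_bot, add_zero, weightedEigenspan,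
    ← iSup_insert] at h

lemma neg_mean_mul_laplacian_le_of_mem_weightedEigenspan (hq : 0 ≤ q.1) (hs : ∀ ν ∈ s, ν ≤ μ)
    (hu : u ∈ weightedEigenspan q s) :
    -mean (u * laplacian u) ≤ μ * mean (q * (u * u)) := by
  rw [weightedEigenspan, iSup_subtype', Submodule.mem_iSup_iff_exists_finsupp] at hu
  obtain ⟨f, hf, hsum⟩ := hu
  have horth (ν : s) (hν : ν ∈ f.support) : mean (q * (u * f ν)) = mean (q * (f ν * f ν)) := by
    rw [← hsum, Finsupp.sum, Finset.sum_mul, Finset.mul_sum, map_sum]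
    exact Finset.sum_eq_single_of_mem ν hν fun ν' _ hne ↦
      mean_mul_eq_zero_of_mem_weightedEigenspace (Subtype.coe_injective.ne hne) (hf ν') (hf ν)
  have hmass : mean (q * (u * u)) = ∑ ν ∈ f.support, mean (q * (f ν * f ν)) := by
    nth_rw 2 [← hsum]
    rw [Finsupp.sum, Finset.mul_sum, Finset.mul_sum, map_sum]
    exact Finset.sum_congr rfl horth
  have henergy : -mean (u * laplacian u) = ∑ ν ∈ f.support, ν * mean (q * (f ν * f ν)) := by
    nth_rw 2 [← hsum]
    rw [Finsupp.sum, map_sum, Finset.mul_sum, map_sum, ← Finset.sum_neg_distrib]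
    refine Finset.sum_congr rfl fun ν hν ↦ ?_
    rw [mean_mul_laplacian_of_mem_weightedEigenspace u (hf ν), neg_mul, neg_neg, horth ν hν]
  rw [henergy, hmass, Finset.mul_sum]
  exact Finset.sum_le_sum fun ν _ ↦ mul_le_mul_of_nonneg_right (hs ν ν.2)
    (mean_nonneg fun p ↦ mul_nonneg (hq p) (mul_self_nonneg _))

end Weighted

lemma sqFourierCoeff_eq_zero {m : Fin 2 → ℤ} {u : SmoothFunction}
    (hm : mean ((cosMode m + sinMode m) * u) = 0)
    (hneg : mean ((cosMode (-m) + sinMode (-m)) * u) = 0) : sqFourierCoeff m u = 0 := by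
  rw [cosMode_neg, sinMode_neg] at hneg
  simp only [add_mul, smul_mul_assoc, map_add, map_smul, smul_eq_mul] at hm hneg
  rw [sqFourierCoeff, show mean (cosMode m * u) = 0 by linarith,
    show mean (sinMode m * u) = 0 by linarith]
  simp

/- The real Fourier modes with frequency in a symmetric set `S` span a space with basis
`cosMode m + sinMode m`, `m ∈ S`. An element of the eigenspan that is orthogonal to it vanishes,
by the Poincaré inequality. -/
lemma rank_weightedEigenspan_le {S : Finset (Fin 2 → ℤ)} {r μ : ℝ} {q : SmoothFunction} {s : Set ℝ}
    (hneg : ∀ m ∈ S, -m ∈ S) (hr : ∀ m ∉ S, r ≤ ∑ i, (m i : ℝ) ^ 2) (hq : 0 ≤ q.1)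
    (hs : ∀ ν ∈ s, ν ≤ μ) (hμ : ∀ p, μ * q.1 p < r) :
    Module.rank ℝ (weightedEigenspan q s) ≤ S.card := by
  let coeff : SmoothFunction →ₗ[ℝ] S → ℝ :=
    LinearMap.pi fun m ↦ mean ∘ₗ LinearMap.mulLeft ℝ (cosMode m + sinMode m)
  have hinj : Function.Injective (coeff.domRestrict (weightedEigenspan q s)) := by
    refine (injective_iff_map_eq_zero _).mpr fun ⟨u, hu⟩ hu0 ↦ Subtype.ext ?_
    have hcoeff (m : Fin 2 → ℤ) (hm : m ∈ S) : mean ((cosMode m + sinMode m) * u) = 0 :=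
      congrFun hu0 ⟨m, hm⟩
    have hpoincare := mul_mean_sq_le_of_sqFourierCoeff_eq_zero (S := S) hr fun m hm ↦
      sqFourierCoeff_eq_zero (hcoeff m hm) (hcoeff (-m) (hneg m hm))
    have henergy := neg_mean_mul_laplacian_le_of_mem_weightedEigenspan hq hs hu
    refine eq_zero_of_mean_mul_sq_nonpos (q := r • 1 + -μ • q)
      (fun p ↦ by simpa using hμ p) ?_
    simp only [add_mul, smul_mul_assoc, one_mul, map_add, map_smul, smul_eq_mul]
    linarith
  simpa using LinearMap.rank_le_of_injective _ hinj

lemma mean_mul_pderiv_self (i : Fin 2) (u : SmoothFunction) : mean (u * pderiv i u) = 0 :=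
  self_eq_neg.mp ((mean_mul_pderiv i u u).trans (by rw [mul_comm]))

lemma linearIndependent_pderiv {i : Fin 2} {u : SmoothFunction} (hu : pderiv i u ≠ 0) :
    LinearIndependent ℝ ![u, pderiv i u] := by
  have hu0 : u ≠ 0 := fun h ↦ hu (by rw [h, map_zero])
  refine (LinearIndependent.pair_iff' hu0).mpr fun c hc ↦ hu ?_
  refine eq_zero_of_mean_mul_sq_nonpos (q := 1) (fun _ ↦ one_pos) ?_
  rw [one_mul]
  nth_rw 1 [← hc]
  rw [smul_mul_assoc, map_smul, mean_mul_pderiv_self, smul_zero]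

lemma two_le_rank_of_pderiv_mem {V : Submodule ℝ SmoothFunction} {i : Fin 2} {u : SmoothFunction}
    (hu : u ∈ V) (hu' : pderiv i u ∈ V) (hne : pderiv i u ≠ 0) : 2 ≤ Module.rank ℝ V := by
  have hli : LinearIndependent ℝ ![(⟨u, hu⟩ : V), ⟨pderiv i u, hu'⟩] := by
    refine .of_comp V.subtype ?_
    convert linearIndependent_pderiv hne using 1
    ext j
    fin_cases j <;> rfl
  simpa using hli.cardinal_le_rank

/-- The frequencies `m` with `|m|² < 2`. -/
def lowFrequencies : Finset (Fin 2 → ℤ) := {0, ![1, 0], ![-1, 0], ![0, 1], ![0, -1]}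

lemma card_lowFrequencies : lowFrequencies.card = 5 := by decide

lemma neg_mem_lowFrequencies : ∀ m ∈ lowFrequencies, -m ∈ lowFrequencies := by decide

lemma two_le_sum_sq_of_notMem_lowFrequencies {m : Fin 2 → ℤ} (hm : m ∉ lowFrequencies) :
    2 ≤ ∑ i, (m i : ℝ) ^ 2 := by
  rw [Fin.sum_univ_two]
  norm_cast
  by_contra! h
  obtain ⟨h0, h0'⟩ : -1 ≤ m 0 ∧ m 0 ≤ 1 := by constructor <;> nlinarith
  obtain ⟨h1, h1'⟩ : -1 ≤ m 1 ∧ m 1 ≤ 1 := by constructor <;> nlinarith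
  refine hm ?_
  rw [show m = ![m 0, m 1] from (List.ofFn_inj.mp rfl)]
  interval_cases m 0 <;> interval_cases m 1 <;> first | decide | simp at h

lemma rank_weightedEigenspan_Iic_le {q : SmoothFunction} {μ : ℝ} (hq : 0 ≤ q.1)
    (hμ : ∀ p, μ * q.1 p < 2) : Module.rank ℝ (weightedEigenspan q (Set.Iic μ)) ≤ 5 := by
  have h := rank_weightedEigenspan_le neg_mem_lowFrequencies
    (fun m hm ↦ two_le_sum_sq_of_notMem_lowFrequencies hm) hq (s := Set.Iic μ) (fun _ hν ↦ hν) hμ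
  simpa [card_lowFrequencies] using h

lemma one_le_rank_weightedEigenspan {s : Set ℝ} (h0 : (0 : ℝ) ∈ s) (q : SmoothFunction) :
    1 ≤ Module.rank ℝ (weightedEigenspan q s) := by
  refine Cardinal.one_le_iff_ne_zero.mpr fun h ↦ ?_
  have h1 := weightedEigenspace_le_weightedEigenspan h0 (one_mem_weightedEigenspace_zero q)
  rw [Submodule.rank_eq_zero.mp h] at h1
  exact one_ne_zero (α := ℝ) (congrFun (congrArg Subtype.val ((Submodule.mem_bot ℝ).mp h1)) 0)

end SmoothFunction

/-! ### Conformally flat metrics -/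

namespace Metric

open SmoothFunction

variable {q : SmoothFunction} {hq : ∀ p, 0 < q.1 p} {μ : ℝ}

/-- The metric `q (dx² + dy²)`. -/
def conformal (q : SmoothFunction) (hq : ∀ p, 0 < q.1 p) : Metric where
  coeff p := q.1 p • 1
  smooth _ _ := q.contDiff.mul contDiff_const
  posDef p := Matrix.PosDef.one.smul (hq p)

lemma laplaceBeltrami_conformal (u : SmoothFunction) (p : Torus) :
    (conformal q hq).laplaceBeltrami u.1 p = (q.1 p)⁻¹ * (laplacian u).1 p := by
  have hsqrt (p : Torus) : Real.sqrt ((conformal q hq).coeff p).det = q.1 p := by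
    simp [conformal, Real.sqrt_sq (hq p).le]
  have hflux (i : Fin 2) : (fun p ↦ ∑ j, Real.sqrt ((conformal q hq).coeff p).det *
      ((conformal q hq).coeff p)⁻¹ i j * partialDeriv j u.1 p) = partialDeriv i u.1 := by
    funext p
    have hinv : ((conformal q hq).coeff p)⁻¹ = (q.1 p)⁻¹ • 1 := by
      have := invertibleOfNonzero (hq p).ne'
      simp [conformal, Matrix.inv_smul]
    simp [hsqrt, hinv, Matrix.one_apply, (hq p).ne']
  simp only [laplaceBeltrami, hflux]
  rw [hsqrt, laplacian_apply]
  simp [coe_pderiv]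

lemma isEigenfunction_conformal_iff {u : SmoothFunction} :
    (conformal q hq).IsEigenfunction μ u.1 ↔ u ≠ 0 ∧ u ∈ weightedEigenspace q μ := by
  have h (p : Torus) : -((q.1 p)⁻¹ * (laplacian u).1 p) = μ * u.1 p ↔
      (laplacian u).1 p = (-μ • (q * u)).1 p := by
    rw [neg_eq_iff_eq_neg, inv_mul_eq_iff_eq_mul₀ (hq p).ne']
    simp [mul_left_comm]
  simp only [IsEigenfunction, laplaceBeltrami_conformal, h, mem_weightedEigenspace,
    Subtype.ext_iff, funext_iff, ne_eq]
  exact ⟨fun hu ↦ ⟨hu.1, hu.2.2⟩, fun hu ↦ ⟨hu.1, u.contDiff, hu.2⟩⟩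

lemma eigenSpan_conformal (s : Set ℝ) : (conformal q hq).eigenSpan s =
    (weightedEigenspan q s).map (smoothFunctions.val : SmoothFunction →ₗ[ℝ] Torus → ℝ) := by
  refine le_antisymm (Submodule.span_le.mpr ?_) ?_
  · rintro u ⟨μ, hμ, hu⟩
    refine ⟨⟨u, hu.2.1⟩, weightedEigenspace_le_weightedEigenspan hμ ?_, rfl⟩
    exact (isEigenfunction_conformal_iff (u := ⟨u, hu.2.1⟩).mp hu).2
  · simp only [weightedEigenspan, Submodule.map_iSup, iSup_le_iff]
    rintro μ hμ _ ⟨u, hu, rfl⟩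
    by_cases h0 : u = 0
    · rw [h0, map_zero]
      exact zero_mem _
    · exact Submodule.subset_span ⟨μ, hμ, isEigenfunction_conformal_iff.mpr ⟨h0, hu⟩⟩

lemma rank_eigenSpan_conformal (s : Set ℝ) : Module.rank ℝ ((conformal q hq).eigenSpan s) =
    Module.rank ℝ (weightedEigenspan q s) := by
  rw [eigenSpan_conformal]
  exact (Submodule.equivMapOfInjective _ Subtype.val_injective _).rank_eq.symm

lemma isKthEigenvalue_conformal {i : Fin 2} {u : SmoothFunction} (hqi : pderiv i q = 0)
    (hμ : 0 < μ) (hμq : ∀ p, μ * q.1 p < 2) (hu : u ∈ weightedEigenspace q μ)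
    (hne : pderiv i u ≠ 0) :
    (conformal q hq).IsKthEigenvalue 2 μ ∨ (conformal q hq).IsKthEigenvalue 3 μ ∨
      (conformal q hq).IsKthEigenvalue 4 μ := by
  have hspace := two_le_rank_of_pderiv_mem hu (pderiv_mem_weightedEigenspace hqi hu) hne
  have hbelow := one_le_rank_weightedEigenspan (Set.mem_Iio.mpr hμ) q
  have htotal := rank_weightedEigenspan_Iic_le (fun p ↦ (hq p).le) hμq
  have hsplit := rank_weightedEigenspan_insert (μ := μ) hq Set.self_notMem_Iio
  simp only [IsKthEigenvalue, rank_eigenSpan_conformal]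
  rw [Set.Iio_insert] at hsplit
  rw [hsplit] at htotal ⊢
  have hfin : (5 : Cardinal) < Cardinal.aleph0 := Cardinal.ofNat_lt_aleph0
  obtain ⟨a, ha⟩ := Cardinal.lt_aleph0.mp ((self_le_add_right _ _).trans_lt (htotal.trans_lt hfin))
  obtain ⟨b, hb⟩ := Cardinal.lt_aleph0.mp ((self_le_add_left _ _).trans_lt (htotal.trans_lt hfin))
  rw [ha] at hspace htotal ⊢
  rw [hb] at hbelow htotal ⊢
  norm_cast at *
  omega

lemma exists_eq_conformal_of_isLiouville {g : Metric} (hg : g.IsLiouville) :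
    ∃ (q : SmoothFunction) (hq : ∀ p, 0 < q.1 p), pderiv 1 q = 0 ∧ g = conformal q hq := by
  obtain ⟨Q, hQ⟩ := hg
  have hcoeff (p : Torus) : g.coeff p 0 0 = Q p.1 := by simp [hQ]
  refine ⟨⟨fun p ↦ g.coeff p 0 0, g.smooth 0 0⟩, fun p ↦ (g.posDef p).diag_pos, ?_, ?_⟩
  · refine Subtype.ext (funext fun p ↦ ?_)
    simp [coe_pderiv, partialDeriv, hcoeff, dir]
  · have hscalar : g.coeff = fun p ↦ g.coeff p 0 0 • 1 :=
      funext fun p ↦ by rw [hcoeff, hQ]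
    cases g
    simp only [conformal]
    congr

end Metric

/-! ### Smooth families of functions -/

section SmallPerturbation

open Filter Topology

lemma contDiffAt_iteratedFDeriv_of_contDiffAt_uncurry {P E F : Type*} [NormedAddCommGroup P]
    [NormedSpace ℝ P] [NormedAddCommGroup E] [NormedSpace ℝ E] [NormedAddCommGroup F]
    [NormedSpace ℝ F] {f : P → E → F} {z₀ : P × E} (hf : ContDiffAt ℝ ∞ (Function.uncurry f) z₀)
    (m : ℕ) : ContDiffAt ℝ ∞ (fun z : P × E ↦ iteratedFDeriv ℝ m (f z.1) z.2) z₀ := by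
  induction m with
  | zero =>
    exact (continuousMultilinearCurryFin0 ℝ E F).symm.contDiff.contDiffAt.comp z₀ hf
  | succ m ih =>
    have hfderiv : ContDiffAt ℝ ∞ (fun z : P × E ↦ fderiv ℝ (iteratedFDeriv ℝ m (f z.1)) z.2) z₀ :=
      ContDiffAt.fderiv (f := fun (z : P × E) y ↦ iteratedFDeriv ℝ m (f z.1) y)
        (ih.comp (z₀, z₀.2) (f := fun w : (P × E) × E ↦ (w.1.1, w.2)) (by fun_prop))
        contDiffAt_snd (by simp)
    exact (continuousMultilinearCurryLeftEquiv ℝ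
      (fun _ : Fin (m + 1) ↦ E) F).symm.contDiff.contDiffAt.comp z₀ hfderiv

lemma iteratedFDeriv_lift_congr (m : ℕ) (u : Torus → ℝ) {q q' : ℝ × ℝ} (h : proj q = proj q') :
    iteratedFDeriv ℝ m (lift u) q = iteratedFDeriv ℝ m (lift u) q' := by
  have hperiodic : (fun z ↦ lift u (z + (q' - q))) = lift u := funext fun z ↦ by
    refine congrArg u (show proj (z + (q' - q)) = proj z from ?_)
    simp only [proj, Prod.mk.injEq] at h
    simp [proj, h.1, h.2]
  rw [← hperiodic, iteratedFDeriv_comp_add_right, hperiodic, add_sub_cancel]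

lemma exists_mem_Icc_proj_eq (p : Torus) :
    ∃ q ∈ Set.Icc (-Real.pi) Real.pi ×ˢ Set.Icc (-Real.pi) Real.pi, proj q = p :=
  ⟨(p.1.toReal, p.2.toReal),
    ⟨⟨p.1.neg_pi_lt_toReal.le, p.1.toReal_le_pi⟩, ⟨p.2.neg_pi_lt_toReal.le, p.2.toReal_le_pi⟩⟩,
    Prod.ext p.1.coe_toReal p.2.coe_toReal⟩

lemma eventually_norm_iteratedFDeriv_lift_lt {P : Type*} [NormedAddCommGroup P] [NormedSpace ℝ P]
    {u : P → Torus → ℝ} {a₀ : P}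
    (hu : ∀ q, ContDiffAt ℝ ∞ (Function.uncurry fun a ↦ lift (u a)) (a₀, q))
    (h0 : u a₀ = 0) (k : ℕ) {ε : ℝ} (hε : 0 < ε) :
    ∀ᶠ a in 𝓝 a₀, ∀ m ≤ k, ∀ q, ‖iteratedFDeriv ℝ m (lift (u a)) q‖ < ε := by
  refine (Set.finite_Iic k).eventually_all.mpr fun m _ ↦ ?_
  have hlocal (q : ℝ × ℝ) : ∀ᶠ z : P × (ℝ × ℝ) in 𝓝 (a₀, q),
      ‖iteratedFDeriv ℝ m (lift (u z.1)) z.2‖ < ε := by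
    refine (contDiffAt_iteratedFDeriv_of_contDiffAt_uncurry (hu q) m).continuousAt.norm.eventually
      (gt_mem_nhds ?_)
    have hlift : lift (u a₀) = 0 := by rw [h0]; rfl
    simpa [hlift] using hε
  filter_upwards [(isCompact_Icc.prod isCompact_Icc).eventually_forall_of_forall_eventually
    (P := fun a q ↦ ‖iteratedFDeriv ℝ m (lift (u a)) q‖ < ε) fun q _ ↦ hlocal q] with a ha q
  obtain ⟨q', hq', hproj⟩ := exists_mem_Icc_proj_eq (proj q)
  exact iteratedFDeriv_lift_congr m (u a) hproj ▸ ha q' hq'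

end SmallPerturbation

/-! ### The eigenfunction and its metric -/

section TrigProduct

open SmoothFunction

/-- The `x`-factor `1 + a cos (n x)` of `trigProduct n a`. -/
def modulation (n : ℕ) (a : ℝ) : SmoothFunction := 1 + a • cosMode ![n, 0]

/-- `trigProduct n a` as an element of `C^∞(𝕋²)`. -/
def smoothTrigProduct (n : ℕ) (a : ℝ) : SmoothFunction := modulation n a * cosMode ![0, 1]

lemma modulation_apply (n : ℕ) (a : ℝ) (p : Torus) :
    (modulation n a).1 p = 1 + a * (n • p.1).cos := by
  simp [modulation, cosMode_apply, phase_apply]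

lemma coe_smoothTrigProduct (n : ℕ) (a : ℝ) : (smoothTrigProduct n a).1 = trigProduct n a :=
  funext fun p ↦ by
    simp [smoothTrigProduct, modulation_apply, cosMode_apply, phase_apply, trigProduct]

lemma pderiv_pderiv_mul_of_pderiv_eq_zero {i : Fin 2} {u : SmoothFunction} (hu : pderiv i u = 0)
    (v : SmoothFunction) : pderiv i (pderiv i (u * v)) = u * pderiv i (pderiv i v) := by
  simp only [Derivation.leibniz, hu, smul_eq_mul, mul_zero, add_zero]

lemma pderiv_one_modulation (n : ℕ) (a : ℝ) : pderiv 1 (modulation n a) = 0 := by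
  simp [modulation, pderiv_cosMode]

lemma pderiv_one_pderiv_one_smoothTrigProduct (n : ℕ) (a : ℝ) :
    pderiv 1 (pderiv 1 (smoothTrigProduct n a)) = (-1 : ℝ) • smoothTrigProduct n a := by
  rw [smoothTrigProduct, pderiv_pderiv_mul_of_pderiv_eq_zero (pderiv_one_modulation n a),
    pderiv_pderiv_cosMode, mul_smul_comm]
  simp

lemma pderiv_zero_pderiv_zero_smoothTrigProduct (n : ℕ) (a : ℝ) :
    pderiv 0 (pderiv 0 (smoothTrigProduct n a)) =
      -(n : ℝ) ^ 2 • (a • cosMode ![n, 0] * cosMode ![0, 1]) := by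
  have hy : pderiv 0 (cosMode ![0, 1]) = 0 := by simp [pderiv_cosMode]
  rw [smoothTrigProduct, mul_comm, pderiv_pderiv_mul_of_pderiv_eq_zero hy, modulation, map_add,
    map_add, Derivation.map_smul, Derivation.map_smul, pderiv_pderiv_cosMode]
  simp [-neg_smul, smul_comm a, mul_comm]

lemma laplacian_smoothTrigProduct (n : ℕ) (a : ℝ) : laplacian (smoothTrigProduct n a) =
    (-1 : ℝ) • ((modulation n a + (n : ℝ) ^ 2 • a • cosMode ![n, 0]) * cosMode ![0, 1]) := by
  rw [laplacian_apply, Fin.sum_univ_two, pderiv_zero_pderiv_zero_smoothTrigProduct,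
    pderiv_one_pderiv_one_smoothTrigProduct, smoothTrigProduct, add_mul, smul_add, add_comm,
    smul_mul_assoc _ (a • _), smul_smul (-1), neg_one_mul]

lemma pderiv_one_smoothTrigProduct_ne_zero {n : ℕ} {a : ℝ} (h : smoothTrigProduct n a ≠ 0) :
    pderiv 1 (smoothTrigProduct n a) ≠ 0 := by
  intro h0
  have h1 := pderiv_one_pderiv_one_smoothTrigProduct n a
  rw [h0, map_zero] at h1
  exact h ((smul_eq_zero.mp h1.symm).resolve_left (by norm_num))

theorem isKthEigenvalue_of_isEigenfunction_trigProduct {n : ℕ} {a : ℝ} {g : Metric}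
    (hg : g.IsLiouville) (hclose : g.IsCkClose 0 1 Metric.flat)
    (hu : g.IsEigenfunction 1 (trigProduct n a)) :
    g.IsKthEigenvalue 2 1 ∨ g.IsKthEigenvalue 3 1 ∨ g.IsKthEigenvalue 4 1 := by
  obtain ⟨q, hq, hqy, rfl⟩ := Metric.exists_eq_conformal_of_isLiouville hg
  rw [← coe_smoothTrigProduct, Metric.isEigenfunction_conformal_iff] at hu
  have hq2 (p : Torus) : q.1 p < 2 := by
    obtain ⟨z, rfl⟩ := proj_surjective p
    have h := hclose 0 le_rfl 0 0 z
    rw [norm_iteratedFDeriv_zero] at h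
    have h' : |q.1 (proj z) - 1| < 1 := by
      simpa [lift, Metric.conformal, Metric.flat, proj] using h
    linarith [(abs_lt.mp h').2]
  exact Metric.isKthEigenvalue_conformal hqy one_pos (by simpa using hq2) hu.2
    (pderiv_one_smoothTrigProduct_ne_zero hu.1)

end TrigProduct

section TrigMetric

open SmoothFunction Filter Topology

lemma abs_angle_cos_le_one (θ : Real.Angle) : |θ.cos| ≤ 1 := by
  induction θ using Real.Angle.induction_on
  exact Real.abs_cos_le_one _

lemma one_add_mul_cos_pos {a : ℝ} (ha : |a| < 1) (x : Real.Angle) : 0 < 1 + a * x.cos := by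
  have h : |a * x.cos| < 1 := by
    rw [abs_mul]
    exact mul_lt_one_of_nonneg_of_lt_one_left (abs_nonneg a) ha (abs_angle_cos_le_one x)
  linarith [(abs_lt.mp h).1]

/-- The conformal factor `1 + n² a cos (n x) / (1 + a cos (n x))`, the function `q` for which
`-Δ₀ Φ = q Φ` with `Φ = trigProduct n a` and the flat Laplacian `Δ₀`. -/
def trigFactor (n : ℕ) (a : ℝ) (p : Torus) : ℝ :=
  1 + n ^ 2 * (a * (n • p.1).cos) / (1 + a * (n • p.1).cos)

lemma abs_lt_one_of_abs_mul_lt_one {n : ℕ} {a : ℝ} (ha : |a| * (n ^ 2 + 1) < 1) : |a| < 1 :=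
  (le_mul_of_one_le_right (abs_nonneg a) (le_add_of_nonneg_left (sq_nonneg _))).trans_lt ha

lemma trigFactor_pos {n : ℕ} {a : ℝ} (ha : |a| * (n ^ 2 + 1) < 1) (p : Torus) :
    0 < trigFactor n a p := by
  have hden := one_add_mul_cos_pos (abs_lt_one_of_abs_mul_lt_one ha) (n • p.1)
  have hnum : 0 < 1 + a * (n ^ 2 + 1) * (n • p.1).cos :=
    one_add_mul_cos_pos (by rwa [abs_mul, abs_of_pos (a := (n ^ 2 + 1 : ℝ)) (by positivity)]) _
  rw [trigFactor, one_add_div hden.ne']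
  exact div_pos (by linarith) hden

lemma analyticAt_lift_trigFactor (n : ℕ) {a : ℝ} (ha : |a| < 1) (z : ℝ × ℝ) :
    AnalyticAt ℝ (Function.uncurry fun a ↦ lift (trigFactor n a)) (a, z) := by
  have hlift : (Function.uncurry fun a ↦ lift (trigFactor n a)) = fun w : ℝ × ℝ × ℝ ↦
      1 + n ^ 2 * (w.1 * Real.cos (n * w.2.1)) / (1 + w.1 * Real.cos (n * w.2.1)) := by
    funext w
    simp [Function.uncurry_def, lift, trigFactor, ← Real.Angle.natCast_mul_eq_nsmul]
  rw [hlift]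
  have hden : 1 + a * Real.cos (n * z.1) ≠ 0 := (one_add_mul_cos_pos ha (n * z.1 : ℝ)).ne'
  have hcos : AnalyticAt ℝ (fun w : ℝ × ℝ × ℝ ↦ Real.cos (n * w.2.1)) (a, z) :=
    Real.analyticAt_cos.comp
      (analyticAt_const.mul (analyticAt_fst.comp (f := fun w : ℝ × ℝ × ℝ ↦ w.2) analyticAt_snd))
  have hmul := analyticAt_fst.mul hcos
  exact analyticAt_const.add
    ((analyticAt_const.mul hmul).div (analyticAt_const.add hmul) hden)

lemma isRealAnalytic_trigFactor (n : ℕ) {a : ℝ} (ha : |a| < 1) :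
    IsRealAnalytic (trigFactor n a) := fun z _ ↦
  (analyticAt_lift_trigFactor n ha z).comp (f := fun z ↦ (a, z)) (by fun_prop)

/-- `trigFactor n a` as an element of `C^∞(𝕋²)`. -/
def smoothTrigFactor (n : ℕ) {a : ℝ} (ha : |a| < 1) : SmoothFunction :=
  ⟨trigFactor n a, (isRealAnalytic_trigFactor n ha).contDiff (n := ∞)⟩

/-- The Liouville metric `q (dx² + dy²)` with `q = trigFactor n a`. -/
def trigMetric (n : ℕ) (a : ℝ) (ha : |a| * (n ^ 2 + 1) < 1) : Metric :=
  .conformal (smoothTrigFactor n (abs_lt_one_of_abs_mul_lt_one ha)) (trigFactor_pos ha)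

section

variable {n : ℕ} {a : ℝ} {ha : |a| * (n ^ 2 + 1) < 1}

lemma isRealAnalytic_trigMetric : (trigMetric n a ha).IsRealAnalytic := fun _ _ ↦
  (isRealAnalytic_trigFactor n (abs_lt_one_of_abs_mul_lt_one ha)).mul analyticOnNhd_const

lemma isLiouville_trigMetric : (trigMetric n a ha).IsLiouville :=
  ⟨fun x ↦ trigFactor n a (x, 0), fun _ ↦ rfl⟩

lemma smoothTrigProduct_mem_weightedEigenspace (ha : |a| < 1) :
    smoothTrigProduct n a ∈ weightedEigenspace (smoothTrigFactor n ha) 1 := by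
  rw [mem_weightedEigenspace, laplacian_smoothTrigProduct, smoothTrigProduct, ← mul_assoc]
  congr 2
  refine Subtype.ext (funext fun p ↦ ?_)
  have hden := (one_add_mul_cos_pos ha (n • p.1)).ne'
  simp [modulation_apply, smoothTrigFactor, trigFactor, cosMode_apply, phase_apply]
  field_simp

lemma smoothTrigProduct_ne_zero (ha : |a| < 1) : smoothTrigProduct n a ≠ 0 := by
  intro h
  have h0 : trigProduct n a 0 = 0 := by rw [← coe_smoothTrigProduct, h]; rfl
  have hpos := one_add_mul_cos_pos ha 0
  simp [trigProduct] at h0 hpos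
  linarith

lemma isEigenfunction_trigMetric : (trigMetric n a ha).IsEigenfunction 1 (trigProduct n a) := by
  have ha1 := abs_lt_one_of_abs_mul_lt_one ha
  rw [← coe_smoothTrigProduct]
  exact Metric.isEigenfunction_conformal_iff.mpr
    ⟨smoothTrigProduct_ne_zero ha1, smoothTrigProduct_mem_weightedEigenspace ha1⟩

end

lemma isCkClose_conformal_flat {q : SmoothFunction} {hq : ∀ p, 0 < q.1 p} {k : ℕ} {ε : ℝ}
    (h : ∀ m ≤ k, ∀ z, ‖iteratedFDeriv ℝ m (lift fun p ↦ q.1 p - 1) z‖ < ε) :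
    (Metric.conformal q hq).IsCkClose k ε Metric.flat := by
  intro m hm i j z
  by_cases hij : i = j
  · simpa [Metric.conformal, Metric.flat, hij] using h m hm z
  · have hzero : lift (fun p ↦ (Metric.conformal q hq).coeff p i j - Metric.flat.coeff p i j) = 0 :=
      funext fun _ ↦ by simp [lift, Metric.conformal, Metric.flat, hij]
    rw [hzero, iteratedFDeriv_zero]
    simpa using (norm_nonneg _).trans_lt (h m hm z)

lemma eventually_isCkClose_trigMetric (n k : ℕ) {ε : ℝ} (hε : 0 < ε) :
    ∀ᶠ a in 𝓝 (0 : ℝ), ∀ ha, (trigMetric n a ha).IsCkClose k ε Metric.flat := by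
  have hsmooth (z : ℝ × ℝ) : ContDiffAt ℝ ∞
      (Function.uncurry fun a ↦ lift fun p ↦ trigFactor n a p - 1) (0, z) :=
    ((analyticAt_lift_trigFactor n (by simp) z).sub analyticAt_const).contDiffAt
  have hzero : (fun p ↦ trigFactor n 0 p - 1) = 0 := funext fun p ↦ by simp [trigFactor]
  filter_upwards [eventually_norm_iteratedFDeriv_lift_lt hsmooth hzero k hε] with a h ha
  exact isCkClose_conformal_flat h

lemma eventually_abs_mul_lt_one (n : ℕ) : ∀ᶠ a : ℝ in 𝓝 0, |a| * (n ^ 2 + 1) < 1 := by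
  have hcont : ContinuousAt (fun a : ℝ ↦ |a| * (n ^ 2 + 1)) 0 := by fun_prop
  exact hcont.eventually (gt_mem_nhds (by simp))

end TrigMetric

/-! ### Connected components -/

section Components

lemma continuousAt_angle_toReal {θ : Real.Angle} (h : θ ≠ Real.pi) :
    ContinuousAt Real.Angle.toReal θ := by
  have : Fact (0 < 2 * Real.pi) := ⟨Real.two_pi_pos⟩
  rw [← Real.Angle.neg_coe_pi, ← Real.Angle.coe_neg] at h
  exact continuous_subtype_val.continuousAt.comp
    (AddCircle.continuousAt_equivIoc (2 * Real.pi) (-Real.pi) h)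

/- `x ↦ f x - (n • f x).toReal / n` is a continuous map to the finite set of `n`-torsion points, so
it separates components, and it agrees with `f` where `f` is `n`-torsion. -/
lemma le_card_connectedComponents_of_torsion_subset_range {X : Type*} [TopologicalSpace X]
    {f : X → Real.Angle} {n : ℕ} (hf : Continuous f) (hn : 0 < n) (hpi : ∀ x, n • f x ≠ Real.pi)
    (htorsion : ∀ θ, n • θ = 0 → θ ∈ Set.range f) :
    (n : ℕ∞) ≤ ENat.card (ConnectedComponents X) := by
  have hpos : Fact (0 < 2 * Real.pi) := ⟨Real.two_pi_pos⟩
  have hfinite : Finite {θ : Real.Angle | n • θ = 0} := AddCircle.finite_torsion (2 * Real.pi) hn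
  have hdiv (r : ℝ) : n • ((r / n : ℝ) : Real.Angle) = r := by
    rw [← Real.Angle.natCast_mul_eq_nsmul, mul_div_cancel₀ _ (by positivity)]
  let φ (x : X) : {θ : Real.Angle | n • θ = 0} :=
    ⟨f x - ((n • f x).toReal / n : ℝ), by simp [smul_sub, hdiv]⟩
  have hφ : Continuous φ := by
    refine (hf.sub <| Real.Angle.continuous_coe.comp ?_).subtype_mk _
    exact (continuous_iff_continuousAt.mpr fun x ↦
      (continuousAt_angle_toReal (hpi x)).comp (f := fun x ↦ n • f x) (by fun_prop)).div_const _
  have hsurj : Function.Surjective hφ.connectedComponentsLift := fun ⟨θ, hθ⟩ ↦ by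
    obtain ⟨x, rfl⟩ := htorsion θ hθ
    exact ⟨x, Subtype.ext (by simp [φ, show n • f x = 0 from hθ])⟩
  let ζ : Real.Angle := (2 * Real.pi / n : ℝ)
  have hζ : addOrderOf ζ = n := AddCircle.addOrderOf_period_div hn
  let power (j : Fin n) : {θ : Real.Angle | n • θ = 0} :=
    ⟨(j : ℕ) • ζ, by simp [smul_comm n, ζ, hdiv]⟩
  have hpower : Function.Injective power := fun i j hij ↦ Fin.ext <|
    nsmul_injOn_Iio_addOrderOf (by simp [hζ]) (by simp [hζ]) (Subtype.ext_iff.mp hij)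
  simpa using ENat.card_le_card_of_injective ((Function.injective_surjInv hsurj).comp hpower)

lemma le_numComponents_trigProduct {n : ℕ} {a : ℝ} (ha : 0 < a) (ha1 : a < 1) :
    (n : ℕ∞) ≤ numComponents {p | 1 < trigProduct n a p} := by
  obtain rfl | hn := n.eq_zero_or_pos
  · simp
  refine le_card_connectedComponents_of_torsion_subset_range (f := fun p ↦ p.1.1) (by fun_prop)
    hn (fun p hp ↦ ?_) fun θ hθ ↦ ⟨⟨(θ, 0), ?_⟩, rfl⟩
  · have hp' : 1 < (1 - a) * p.1.2.cos := by
      simpa [trigProduct, hp, ← sub_eq_add_neg] using p.2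
    nlinarith [(abs_le.mp (abs_angle_cos_le_one p.1.2)).2]
  · simpa [trigProduct, hθ] using ha

end Components

open Filter Topology in
theorem exists_metric_trigProduct (n k : ℕ) {ε : ℝ} (hε : 0 < ε) :
    ∃ a₀ : ℝ, 0 < a₀ ∧ ∀ a : ℝ, 0 < a → a < a₀ →
      ∃ g : Metric, g.IsRealAnalytic ∧ g.IsLiouville ∧ g.IsCkClose k ε Metric.flat ∧
        g.IsEigenfunction 1 (trigProduct n a) ∧
        (n : ℕ∞) ≤ numComponents {p | 1 < trigProduct n a p} := by
  have hsmall : ∀ᶠ a : ℝ in 𝓝[>] 0, |a| * (n ^ 2 + 1) < 1 ∧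
      ∀ ha, (trigMetric n a ha).IsCkClose k ε Metric.flat := nhdsWithin_le_nhds <|
    (eventually_abs_mul_lt_one n).and (eventually_isCkClose_trigMetric n k hε)
  obtain ⟨a₀, ha₀, hsmall⟩ := mem_nhdsGT_iff_exists_Ioo_subset.mp hsmall
  refine ⟨a₀, ha₀, fun a ha haa₀ ↦ ?_⟩
  obtain ⟨hpos, hclose⟩ := hsmall ⟨ha, haa₀⟩
  exact ⟨trigMetric n a hpos, isRealAnalytic_trigMetric, isLiouville_trigMetric, hclose hpos,
    isEigenfunction_trigMetric,
    le_numComponents_trigProduct ha (lt_of_abs_lt (abs_lt_one_of_abs_mul_lt_one hpos))⟩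

end Torus

end

theorem proposition4p4_general (n : ℕ) :
    (∀ (k : ℕ) (ε : ℝ), 0 < ε → ∃ a₀ : ℝ, 0 < a₀ ∧ ∀ a : ℝ, 0 < a → a < a₀ →
      ∃ g : Torus.Metric, g.IsRealAnalytic ∧ g.IsLiouville ∧
        Torus.Metric.IsCkClose k ε g Torus.Metric.flat ∧
        g.IsEigenfunction 1 (Torus.trigProduct n a) ∧
        (n : ℕ∞) ≤ Torus.numComponents {p | 1 < Torus.trigProduct n a p}) ∧
    (∃ δ : ℝ, 0 < δ ∧ ∀ (a : ℝ) (g : Torus.Metric), g.IsLiouville →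
      Torus.Metric.IsCkClose 0 δ g Torus.Metric.flat →
      g.IsEigenfunction 1 (Torus.trigProduct n a) →
      g.IsKthEigenvalue 2 1 ∨ g.IsKthEigenvalue 3 1 ∨ g.IsKthEigenvalue 4 1) :=
  ⟨fun k _ hε ↦ Torus.exists_metric_trigProduct n k hε,
    1, one_pos, fun _ _ ↦ Torus.isKthEigenvalue_of_isEigenfunction_trigProduct⟩

theorem proposition4p4 (n : ℕ) :
    (∀ (k : ℕ) (ε : ℝ), 0 < ε → ∃ a₀ : ℝ, 0 < a₀ ∧ ∀ a : ℝ, 0 < a → a < a₀ →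
      ∃ g : Torus.Metric, g.IsRealAnalytic ∧ g.IsLiouville ∧
        Torus.Metric.IsCkClose k ε g Torus.Metric.flat ∧
        g.IsEigenfunction 1 (Torus.trigProduct n a) ∧
        (n : ℕ∞) ≤ Torus.numComponents {p | 1 < Torus.trigProduct n a p}) ∧
    (4 ≤ n → ∃ δ : ℝ, 0 < δ ∧ ∀ (a : ℝ) (g : Torus.Metric), g.IsRealAnalytic → g.IsLiouville →
      Torus.Metric.IsCkClose 0 δ g Torus.Metric.flat →
      g.IsEigenfunction 1 (Torus.trigProduct n a) →
      g.IsKthEigenvalue 2 1 ∨ g.IsKthEigenvalue 3 1 ∨ g.IsKthEigenvalue 4 1) := by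
  obtain ⟨hmetric, δ, hδ, heigenvalue⟩ := proposition4p4_general n
  exact ⟨hmetric, fun _ ↦ ⟨δ, hδ, fun a g _ ↦ heigenvalue a g⟩⟩
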